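/- Let $3\le m\le n$, let $\omega_1=e^{2\pi i/(n-1)}$ and $\omega_2=e^{2\pi i/(m-1)}$, and let $|0\rangle,\dots,|d-1\rangle$ be the standard basis of $\mathbb{C}^d$. In $\mathbb{C}^m\otimes\mathbb{C}^n$ (the first factor is held by Alice, the second by Bob) consider the (unnormalized) product states $$|0\rangle\otimes\sum_{j=0}^{n-2}\omega_1^{\sigma j}|j\rangle,\qquad \Big(\sum_{j=0}^{m-2}\omega_2^{\eta j}|j\rangle\Big)\otimes|n-1\rangle,$$ $$|m-1\rangle\otimes\sum_{j=0}^{n-2}\omega_1^{\sigma j}|j+1\rangle,\qquad \Big(\sum_{j=0}^{m-2}\omega_2^{\eta j}|j+1\rangle\Big)\otimes|0\rangle,$$ where $\sigma=0,1,\dots,n-2$ and $\eta=0,1,\dots,m-2$. These form a set of exactly $2(m+n)-4$ mutually orthogonal nonzero product states, and this set is nonlocal: no protocol of local operations and classical communication (LOCC), i.e. no finite sequence of local quantum operations by Alice and Bob with finitely many outcomes, each of which is communicated and may determine the further course, identifies every state of the set with probability one. Moreover, if $M$ is a linear operator from $\mathbb{C}^m$ (resp. $\mathbb{C}^n$) to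 some $\mathbb{C}^a$ such that the vectors $(M\otimes I)|\phi\rangle$ (resp. $(I\otimes M)|\phi\rangle$), with $|\phi\rangle$ running over the set, are mutually orthogonal, then $M^\dagger M$ is a multiple of the identity. -/

import Mathlib

open scoped TensorProduct

/-- The state space `ℂ^d` of one party, with its standard inner product. -/
abbrev Qudit (d : ℕ) : Type := EuclideanSpace ℂ (Fin d)

/-- The computational basis vector `|k⟩` of `ℂ^d`, for `k < d` (it is `0` for `k ≥ d`). -/
noncomputable def ket (d k : ℕ) : Qudit d :=
  WithLp.toLp 2 fun i => if (i : ℕ) = k then 1 else 0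

/-- A local operator `M ⊗ I` applied by Alice. -/
noncomputable def aliceOp {a a' : ℕ} (b : ℕ) (M : Qudit a →ₗ[ℂ] Qudit a') :
    Qudit a ⊗[ℂ] Qudit b →ₗ[ℂ] Qudit a' ⊗[ℂ] Qudit b :=
  TensorProduct.map M LinearMap.id

/-- A local operator `I ⊗ M` applied by Bob. -/
noncomputable def bobOp (a : ℕ) {b b' : ℕ} (M : Qudit b →ₗ[ℂ] Qudit b') :
    Qudit a ⊗[ℂ] Qudit b →ₗ[ℂ] Qudit a ⊗[ℂ] Qudit b' :=
  TensorProduct.map LinearMap.id M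

/-- A (finite) LOCC protocol on `ℂ^a ⊗ ℂ^b` whose final classical output lies in `J`.
Either the protocol stops and announces an output, or one of the parties performs a quantum
instrument on his or her own system and broadcasts its outcome `k`; the continuation may depend
on `k`. Outcome `k` of the instrument is the completely positive map with the Kraus operators
`M k i`, `i < r k`, from the present local system to a local system of dimension `a' k`
(so adding ancillas, discarding subsystems, coarse-grained outcomes, local and shared
randomness are all included; `r k = 1` gives a measurement with POVM elements `(M k)† M k`). -/
inductive LOCCProtocol (J : Type) : ℕ → ℕ → Type
  | announce {a b : ℕ} (j : J) : LOCCProtocol J a b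
  | alice {a b : ℕ} (l : ℕ) (r a' : Fin l → ℕ)
      (M : ∀ k, Fin (r k) → (Qudit a →ₗ[ℂ] Qudit (a' k)))
      (complete : ∑ k, ∑ i, LinearMap.adjoint (M k i) ∘ₗ M k i = LinearMap.id)
      (next : ∀ k, LOCCProtocol J (a' k) b) : LOCCProtocol J a b
  | bob {a b : ℕ} (l : ℕ) (r b' : Fin l → ℕ)
      (M : ∀ k, Fin (r k) → (Qudit b →ₗ[ℂ] Qudit (b' k)))
      (complete : ∑ k, ∑ i, LinearMap.adjoint (M k i) ∘ₗ M k i = LinearMap.id)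
      (next : ∀ k, LOCCProtocol J a (b' k)) : LOCCProtocol J a b

open Classical in
/-- `P.weight ψ j` is `‖ψ‖²` times the probability that the protocol `P`, run on the (not
necessarily normalized) state `ψ`, outputs `j`. When an outcome has several Kraus operators the
state after it is a mixture, and the weight of a mixture is the sum of the weights. -/
noncomputable def LOCCProtocol.weight {J : Type} :
    {a b : ℕ} → LOCCProtocol J a b → Qudit a ⊗[ℂ] Qudit b → J → ℝ
  | _, _, .announce j', ψ, j => if j' = j then ‖ψ‖ ^ 2 else 0
  | _, b, .alice _ _ _ M _ next, ψ, j => ∑ k, ∑ i, (next k).weight (aliceOp b (M k i) ψ) j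
  | a, _, .bob _ _ _ M _ next, ψ, j => ∑ k, ∑ i, (next k).weight (bobOp a (M k i) ψ) j

/-- The states in `S` can be exactly discriminated by LOCC: some LOCC protocol, run on any
state of `S`, identifies this state with probability one. -/
def LOCCDistinguishable {m n : ℕ} (S : Set (Qudit m ⊗[ℂ] Qudit n)) : Prop :=
  ∃ P : LOCCProtocol S m n, ∀ ψ : S, P.weight ψ ψ = ‖(ψ : Qudit m ⊗[ℂ] Qudit n)‖ ^ 2

/-- `S` is a set of (not necessarily normalized) mutually orthogonal product states. -/
def IsOPS {m n : ℕ} (S : Set (Qudit m ⊗[ℂ] Qudit n)) : Prop :=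
  (∀ ψ ∈ S, ψ ≠ 0 ∧ ∃ (x : Qudit m) (y : Qudit n), ψ = x ⊗ₜ[ℂ] y) ∧
    S.Pairwise fun φ ψ => inner ℂ φ ψ = 0

/-- A nonlocal set: orthogonal product states that LOCC cannot exactly discriminate. -/
def IsNonlocal {m n : ℕ} (S : Set (Qudit m ⊗[ℂ] Qudit n)) : Prop :=
  IsOPS S ∧ ¬ LOCCDistinguishable S

/-- `exp (2πi / (d - 1))`. -/
noncomputable def stripRoot (d : ℕ) : ℂ :=
  Complex.exp (2 * Real.pi * Complex.I / ((d : ℂ) - 1))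

/-- `∑_{j=0}^{d-2} ω^{s j} |j⟩` in `ℂ^d`, where `ω = exp (2πi / (d - 1))`. -/
noncomputable def lowFourier (d s : ℕ) : Qudit d :=
  ∑ j ∈ Finset.range (d - 1), stripRoot d ^ (s * j) • ket d j

/-- `∑_{j=0}^{d-2} ω^{s j} |j+1⟩` in `ℂ^d`, where `ω = exp (2πi / (d - 1))`. -/
noncomputable def highFourier (d s : ℕ) : Qudit d :=
  ∑ j ∈ Finset.range (d - 1), stripRoot d ^ (s * j) • ket d (j + 1)

/-- The four boundary strips of product states in `ℂ^m ⊗ ℂ^n`. -/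
def stripSet (m n : ℕ) : Set (Qudit m ⊗[ℂ] Qudit n) :=
  {ψ | (∃ σ < n - 1, ψ = ket m 0 ⊗ₜ[ℂ] lowFourier n σ) ∨
       (∃ η < m - 1, ψ = lowFourier m η ⊗ₜ[ℂ] ket n (n - 1)) ∨
       (∃ σ < n - 1, ψ = ket m (m - 1) ⊗ₜ[ℂ] highFourier n σ) ∨
       (∃ η < m - 1, ψ = highFourier m η ⊗ₜ[ℂ] ket n 0)}

/-! Nonlocality follows from rigidity: a local operator that keeps the strip states orthogonal is a
multiple of an isometry, hence reveals nothing. Rigidity (`adjoint_comp_eq_smul_of_fourier`) is a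
statement about the Gram matrix of the vectors `M |k⟩`. A strip whose Fourier factor belongs to the
measuring party makes a block of size d - 1 circulant, by Fourier inversion. Pairs of adjacent
strips make the column of an end vector diagonal, so each block is scalar
(`inner_eq_of_dft_orthogonal`). The low and high blocks overlap because d ≥ 3, so their scalars
agree. For a protocol, states with disjoint sets of possible outputs are orthogonal
(`inner_eq_zero_of_weight`). If no state ever produced a wrong output, the states would stay
orthogonal on every branch, so every Kraus operator would act conformally. By completeness some
branch has a nonzero factor. Following such branches leads to a leaf where all states survive but
only one name is announced; `exists_weight_ne_zero` runs this induction. -/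

/-- The orthogonality relations for the characters of a finite cyclic group. -/
lemma IsPrimitiveRoot.sum_pow_mul_conj_pow {N : ℕ} {ω : ℂ} (hω : IsPrimitiveRoot ω N) {i j : ℕ}
    (hi : i < N) (hj : j < N) :
    ∑ s ∈ Finset.range N, ω ^ (s * i) * (starRingEnd ℂ) (ω ^ (s * j)) =
      if i = j then (N : ℂ) else 0 := by
  have hN : N ≠ 0 := by omega
  have hω0 : ω ≠ 0 := hω.ne_zero hN
  have hconj : (starRingEnd ℂ) ω = ω⁻¹ := by
    rw [Complex.inv_def, Complex.normSq_eq_norm_sq, hω.norm'_eq_one hN]; simp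
  have hterm : ∀ s, ω ^ (s * i) * (starRingEnd ℂ) (ω ^ (s * j)) = (ω ^ i * (ω ^ j)⁻¹) ^ s := by
    intro s
    rw [map_pow, hconj, mul_pow, inv_pow, inv_pow, ← pow_mul, ← pow_mul, mul_comm i, mul_comm j]
  simp only [hterm]
  split_ifs with h
  · subst h
    simp [mul_inv_cancel₀ (pow_ne_zero i hω0)]
  · have h1 : ω ^ i * (ω ^ j)⁻¹ ≠ 1 := by
      intro h1
      exact h (hω.pow_inj hi hj (by rwa [mul_inv_eq_one₀ (pow_ne_zero j hω0)] at h1))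
    have h2 : (ω ^ i * (ω ^ j)⁻¹) ^ N = 1 := by
      rw [mul_pow, inv_pow, ← pow_mul, ← pow_mul, mul_comm i, mul_comm j, pow_mul, pow_mul,
        hω.pow_eq_one]
      simp
    rw [geom_sum_eq h1, h2]
    simp

/-! ### Fourier inversion and circulant Gram matrices -/

section Fourier

variable {H : Type*} [NormedAddCommGroup H] [InnerProductSpace ℂ H]

/-- The unnormalized discrete Fourier transform of a family of vectors. -/
def dft (ω : ℂ) (N : ℕ) (e : ℕ → H) (s : ℕ) : H :=
  ∑ j ∈ Finset.range N, ω ^ (s * j) • e j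

lemma sum_conj_smul_dft {N : ℕ} {ω : ℂ} (hω : IsPrimitiveRoot ω N) (e : ℕ → H) {j : ℕ}
    (hj : j < N) :
    ∑ s ∈ Finset.range N, (starRingEnd ℂ) (ω ^ (s * j)) • dft ω N e s = (N : ℂ) • e j := by
  simp only [dft, Finset.smul_sum, smul_smul]
  rw [Finset.sum_comm]
  simp only [← Finset.sum_smul]
  rw [Finset.sum_eq_single j]
  · congr 1
    simpa [mul_comm] using hω.sum_pow_mul_conj_pow hj hj
  · intro k hk hkj
    have := hω.sum_pow_mul_conj_pow (Finset.mem_range.1 hk) hj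
    rw [if_neg hkj] at this
    simp only [mul_comm] at this ⊢
    rw [this, zero_smul]
  · intro h; exact absurd (Finset.mem_range.2 hj) h

/-- By Fourier inversion each `e j` lies in the span of the transformed vectors. -/
lemma inner_eq_zero_of_dft {N : ℕ} {ω : ℂ} (hω : IsPrimitiveRoot ω N) (e : ℕ → H) (x : H)
    (h : ∀ s < N, inner ℂ (dft ω N e s) x = 0) {j : ℕ} (hj : j < N) : inner ℂ (e j) x = 0 := by
  have hN : (N : ℂ) ≠ 0 := by exact_mod_cast (by omega : N ≠ 0)
  have h1 : inner ℂ ((N : ℂ) • e j) x = 0 := by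
    rw [← sum_conj_smul_dft hω e hj, sum_inner]
    refine Finset.sum_eq_zero fun s hs => ?_
    rw [inner_smul_left, h s (Finset.mem_range.1 hs), mul_zero]
  simpa [inner_smul_left, hN] using h1

/-- If the Fourier transform of `e` is orthogonal, the Gram matrix of `e` is circulant. If in
addition one column of it is diagonal, it is scalar. -/
lemma inner_eq_of_dft_orthogonal {N : ℕ} {ω : ℂ} (hω : IsPrimitiveRoot ω N) (e : ℕ → H)
    (horth : ∀ s < N, ∀ t < N, s ≠ t → inner ℂ (dft ω N e s) (dft ω N e t) = 0) {k : ℕ}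
    (hk : k < N) (hcol : ∀ i < N, i ≠ k → inner ℂ (e i) (e k) = 0) {i j : ℕ} (hi : i < N)
    (hj : j < N) :
    inner ℂ (e i) (e j) = if i = j then inner ℂ (e k) (e k) else 0 := by
  have hN0 : N ≠ 0 := by omega
  have hN : (N : ℂ) ≠ 0 := by exact_mod_cast hN0
  have hω0 : ω ≠ 0 := hω.ne_zero hN0
  -- Write `e l` by Fourier inversion; orthogonality leaves only the term of frequency `s`.
  have expand : ∀ s < N, ∀ l < N, (N : ℂ) * inner ℂ (dft ω N e s) (e l) =
      (starRingEnd ℂ) (ω ^ (s * l)) * inner ℂ (dft ω N e s) (dft ω N e s) := by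
    intro s hs l hl
    rw [← inner_smul_right, ← sum_conj_smul_dft hω e hl, inner_sum,
      Finset.sum_eq_single s, inner_smul_right]
    · intro t ht hts
      rw [inner_smul_right, horth s hs t (Finset.mem_range.1 ht) hts.symm, mul_zero]
    · intro h; exact absurd (Finset.mem_range.2 hs) h
  -- Computing the product of the transform with `e k` a second time, from the diagonal column,
  -- shows that all transformed vectors have the same norm. The Gram matrix is then the inverse
  -- transform of a constant.
  have diag : ∀ s < N, inner ℂ (dft ω N e s) (dft ω N e s) = N * inner ℂ (e k) (e k) := by
    intro s hs
    have h1 : inner ℂ (dft ω N e s) (e k) =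
        (starRingEnd ℂ) (ω ^ (s * k)) * inner ℂ (e k) (e k) := by
      rw [dft, sum_inner, Finset.sum_eq_single k, inner_smul_left]
      · intro l hl hlk
        rw [inner_smul_left, hcol l (Finset.mem_range.1 hl) hlk, mul_zero]
      · intro h; exact absurd (Finset.mem_range.2 hk) h
    have h2 := expand s hs k hk
    rw [h1] at h2
    have h3 : (starRingEnd ℂ) (ω ^ (s * k)) ≠ 0 := by
      simpa using fun h : ω = 0 => absurd h hω0
    apply mul_left_cancel₀ h3
    rw [← h2]; ring
  have h1 : (N : ℂ) * inner ℂ (e i) (e j) =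
      ∑ s ∈ Finset.range N, ω ^ (s * i) * inner ℂ (dft ω N e s) (e j) := by
    have : (N : ℂ) * inner ℂ (e i) (e j) = inner ℂ ((N : ℂ) • e i) (e j) := by
      simp [mul_comm]
    rw [this, ← sum_conj_smul_dft hω e hi, sum_inner]
    simp only [inner_smul_left, RingHomCompTriple.comp_apply, RingHom.id_apply]
  have h2 : ∀ s ∈ Finset.range N, ω ^ (s * i) * inner ℂ (dft ω N e s) (e j) =
      (ω ^ (s * i) * (starRingEnd ℂ) (ω ^ (s * j))) * inner ℂ (e k) (e k) := by
    intro s hs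
    have h3 := expand s (Finset.mem_range.1 hs) j hj
    rw [diag s (Finset.mem_range.1 hs)] at h3
    have h4 : inner ℂ (dft ω N e s) (e j) =
        (starRingEnd ℂ) (ω ^ (s * j)) * inner ℂ (e k) (e k) := by
      apply mul_left_cancel₀ hN
      rw [h3]; ring
    rw [h4]; ring
  rw [Finset.sum_congr rfl h2, ← Finset.sum_mul, hω.sum_pow_mul_conj_pow hi hj] at h1
  apply mul_left_cancel₀ hN
  rw [h1]
  split_ifs <;> simp

end Fourier

/-! ### Rigidity of a single local operator -/

lemma isPrimitiveRoot_stripRoot {d : ℕ} (hd : 2 ≤ d) : IsPrimitiveRoot (stripRoot d) (d - 1) := by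
  have h := Complex.isPrimitiveRoot_exp (d - 1) (by omega)
  rwa [Nat.cast_sub (by omega), Nat.cast_one] at h

lemma map_lowFourier {d : ℕ} {H : Type*} [AddCommGroup H] [Module ℂ H] (M : Qudit d →ₗ[ℂ] H)
    (s : ℕ) : M (lowFourier d s) =
      ∑ j ∈ Finset.range (d - 1), stripRoot d ^ (s * j) • M (ket d j) := by
  simp [lowFourier]

lemma map_highFourier {d : ℕ} {H : Type*} [AddCommGroup H] [Module ℂ H] (M : Qudit d →ₗ[ℂ] H)
    (s : ℕ) : M (highFourier d s) =
      ∑ j ∈ Finset.range (d - 1), stripRoot d ^ (s * j) • M (ket d (j + 1)) := by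
  simp [highFourier]

lemma ket_eq_single {d : ℕ} (i : Fin d) : ket d i = EuclideanSpace.single i 1 := by
  ext j
  simp [ket, Fin.ext_iff]

lemma inner_ket_ket {d i j : ℕ} (hi : i < d) :
    inner ℂ (ket d i) (ket d j) = if i = j then 1 else 0 := by
  rw [show ket d i = EuclideanSpace.single (⟨i, hi⟩ : Fin d) 1 from ket_eq_single ⟨i, hi⟩,
    EuclideanSpace.inner_single_left]
  simp [ket]

lemma exists_adjoint_comp_eq_smul_id {d a : ℕ} {M : Qudit d →ₗ[ℂ] Qudit a} {c : ℂ}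
    (h : ∀ i < d, ∀ j < d, inner ℂ (M (ket d i)) (M (ket d j)) = if i = j then c else 0) :
    LinearMap.adjoint M ∘ₗ M = c • LinearMap.id := by
  refine (EuclideanSpace.basisFun (Fin d) ℂ).toBasis.ext fun j => ?_
  refine InnerProductSpace.ext_inner_left_basis (EuclideanSpace.basisFun (Fin d) ℂ).toBasis fun i => ?_
  simp only [OrthonormalBasis.coe_toBasis, EuclideanSpace.basisFun_apply, ← ket_eq_single,
    LinearMap.comp_apply, LinearMap.adjoint_inner_right, LinearMap.smul_apply, LinearMap.id_apply,
    inner_smul_right]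
  rw [h i i.2 j j.2, inner_ket_ket i.2]
  split_ifs <;> simp

/-- An operator preserving the orthogonality of both Fourier families, that of the low family and
the last ket, and that of the high family and the first ket, is a multiple of an isometry. -/
lemma adjoint_comp_eq_smul_of_fourier {d a : ℕ} (hd : 3 ≤ d) (M : Qudit d →ₗ[ℂ] Qudit a)
    (hlow : ∀ s < d - 1, ∀ t < d - 1, s ≠ t →
      inner ℂ (M (lowFourier d s)) (M (lowFourier d t)) = 0)
    (hhigh : ∀ s < d - 1, ∀ t < d - 1, s ≠ t →
      inner ℂ (M (highFourier d s)) (M (highFourier d t)) = 0)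
    (hlast : ∀ s < d - 1, inner ℂ (M (lowFourier d s)) (M (ket d (d - 1))) = 0)
    (hfirst : ∀ s < d - 1, inner ℂ (M (highFourier d s)) (M (ket d 0)) = 0) :
    ∃ c : ℂ, LinearMap.adjoint M ∘ₗ M = c • LinearMap.id := by
  have hω := isPrimitiveRoot_stripRoot (d := d) (by omega)
  simp only [map_lowFourier, map_highFourier] at hlow hhigh hlast hfirst
  have last0 : ∀ i < d - 1, inner ℂ (M (ket d i)) (M (ket d (d - 1))) = 0 := fun i hi =>
    inner_eq_zero_of_dft hω (fun j => M (ket d j)) _ hlast hi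
  have first0 : ∀ i < d - 1, inner ℂ (M (ket d (i + 1))) (M (ket d 0)) = 0 := fun i hi =>
    inner_eq_zero_of_dft hω (fun j => M (ket d (j + 1))) _ hfirst hi
  have low := fun i hi j hj => inner_eq_of_dft_orthogonal hω (fun j => M (ket d j)) hlow
    (k := 0) (by omega)
    (fun i hi h => by
      obtain ⟨i, rfl⟩ := Nat.exists_eq_succ_of_ne_zero h
      exact first0 i (by omega)) (i := i) (j := j) hi hj
  have high := fun i hi j hj => inner_eq_of_dft_orthogonal hω (fun j => M (ket d (j + 1))) hhigh
    (k := d - 2) (by omega)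
    (fun i hi h => by
      have := last0 (i + 1) (by omega)
      rwa [show d - 1 = d - 2 + 1 by omega] at this) (i := i) (j := j) hi hj
  -- The ket `|1⟩` has index 1 in the low block and index 0 in the high block, so both blocks carry
  -- the same scalar. This is where `3 ≤ d` enters.
  have h1 := low 1 (by omega) 1 (by omega)
  have h2 := high 0 (by omega) 0 (by omega)
  rw [if_pos rfl] at h1 h2
  rw [zero_add] at h2
  rw [← h1] at low
  rw [← h2] at high
  refine ⟨_, exists_adjoint_comp_eq_smul_id
    (c := inner ℂ (M (ket d 1)) (M (ket d 1))) fun i hi j hj => ?_⟩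
  by_cases hi' : i < d - 1
  · by_cases hj' : j < d - 1
    · exact low i hi' j hj'
    · obtain rfl : j = d - 1 := by omega
      rw [last0 i hi', if_neg (by omega)]
  · obtain rfl : i = d - 1 := by omega
    by_cases hj' : j < d - 1
    · rw [inner_eq_zero_symm.1 (last0 j hj'), if_neg (by omega)]
    · obtain rfl : j = d - 1 := by omega
      have := high (d - 2) (by omega) (d - 2) (by omega)
      rw [if_pos rfl, show d - 2 + 1 = d - 1 by omega] at this
      rw [if_pos rfl, this]

/-! ### Local operators and instruments on the tensor product -/

lemma map_comp_smul {a a' b b' : ℕ} {M : Qudit a →ₗ[ℂ] Qudit a'} {N : Qudit b →ₗ[ℂ] Qudit b'}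
    {c d : ℂ} (hM : LinearMap.adjoint M ∘ₗ M = c • LinearMap.id)
    (hN : LinearMap.adjoint N ∘ₗ N = d • LinearMap.id) (φ ψ : Qudit a ⊗[ℂ] Qudit b) :
    inner ℂ (TensorProduct.map M N φ) (TensorProduct.map M N ψ) = c * d * inner ℂ φ ψ := by
  rw [← LinearMap.adjoint_inner_right, TensorProduct.adjoint_map, ← LinearMap.comp_apply,
    ← TensorProduct.map_comp, hM, hN, TensorProduct.map_smul_left, TensorProduct.map_smul_right,
    TensorProduct.map_id]
  simp [inner_smul_right, mul_assoc]

lemma inner_self_eq_ofReal_norm_sq {a b : ℕ} (ψ : Qudit a ⊗[ℂ] Qudit b) :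
    inner ℂ ψ ψ = ((‖ψ‖ ^ 2 : ℝ) : ℂ) :=
  (inner_self_eq_norm_sq_to_K (𝕜 := ℂ) ψ).trans (by push_cast; rfl)

section Instrument

variable {ι : Type*} [Fintype ι] {κ : ι → Type*} [∀ k, Fintype (κ k)] {a b : ℕ}

/-- Completeness survives tensoring with the identity, so an instrument conserves total inner
products, not only total norms. -/
lemma sum_inner_aliceOp {a' : ι → ℕ} (M : ∀ k, κ k → (Qudit a →ₗ[ℂ] Qudit (a' k)))
    (complete : ∑ k, ∑ i, LinearMap.adjoint (M k i) ∘ₗ M k i = LinearMap.id)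
    (φ ψ : Qudit a ⊗[ℂ] Qudit b) :
    ∑ k, ∑ i, inner ℂ (aliceOp b (M k i) φ) (aliceOp b (M k i) ψ) = inner ℂ φ ψ := by
  have h : ∀ k i, inner ℂ (aliceOp b (M k i) φ) (aliceOp b (M k i) ψ) =
      inner ℂ φ (LinearMap.rTensor (Qudit b) (LinearMap.adjoint (M k i) ∘ₗ M k i) ψ) := by
    intro k i
    rw [aliceOp, ← LinearMap.rTensor, ← LinearMap.adjoint_inner_right,
      LinearMap.adjoint_rTensor, LinearMap.rTensor_comp, LinearMap.comp_apply]
  have hsum : ∑ k, ∑ i, LinearMap.rTensor (Qudit b) (LinearMap.adjoint (M k i) ∘ₗ M k i) ψ =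
      ψ := by
    simp only [← LinearMap.coe_rTensorHom, ← LinearMap.sum_apply, ← map_sum]
    simp [complete]
  conv_rhs => rw [← hsum]
  rw [inner_sum]
  refine Finset.sum_congr rfl fun k _ => ?_
  rw [inner_sum]
  exact Finset.sum_congr rfl fun i _ => h k i

lemma sum_inner_bobOp {b' : ι → ℕ} (M : ∀ k, κ k → (Qudit b →ₗ[ℂ] Qudit (b' k)))
    (complete : ∑ k, ∑ i, LinearMap.adjoint (M k i) ∘ₗ M k i = LinearMap.id)
    (φ ψ : Qudit a ⊗[ℂ] Qudit b) :
    ∑ k, ∑ i, inner ℂ (bobOp a (M k i) φ) (bobOp a (M k i) ψ) = inner ℂ φ ψ := by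
  have h : ∀ k i, inner ℂ (bobOp a (M k i) φ) (bobOp a (M k i) ψ) =
      inner ℂ φ (LinearMap.lTensor (Qudit a) (LinearMap.adjoint (M k i) ∘ₗ M k i) ψ) := by
    intro k i
    rw [bobOp, ← LinearMap.lTensor, ← LinearMap.adjoint_inner_right,
      LinearMap.adjoint_lTensor, LinearMap.lTensor_comp, LinearMap.comp_apply]
  have hsum : ∑ k, ∑ i, LinearMap.lTensor (Qudit a) (LinearMap.adjoint (M k i) ∘ₗ M k i) ψ =
      ψ := by
    simp only [← LinearMap.coe_lTensorHom, ← LinearMap.sum_apply, ← map_sum]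
    simp [complete]
  conv_rhs => rw [← hsum]
  rw [inner_sum]
  refine Finset.sum_congr rfl fun k _ => ?_
  rw [inner_sum]
  exact Finset.sum_congr rfl fun i _ => h k i

lemma sum_norm_sq_aliceOp {a' : ι → ℕ} (M : ∀ k, κ k → (Qudit a →ₗ[ℂ] Qudit (a' k)))
    (complete : ∑ k, ∑ i, LinearMap.adjoint (M k i) ∘ₗ M k i = LinearMap.id)
    (ψ : Qudit a ⊗[ℂ] Qudit b) : ∑ k, ∑ i, ‖aliceOp b (M k i) ψ‖ ^ 2 = ‖ψ‖ ^ 2 := by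
  have h := sum_inner_aliceOp M complete ψ ψ
  simp only [inner_self_eq_ofReal_norm_sq] at h
  exact_mod_cast h

lemma sum_norm_sq_bobOp {b' : ι → ℕ} (M : ∀ k, κ k → (Qudit b →ₗ[ℂ] Qudit (b' k)))
    (complete : ∑ k, ∑ i, LinearMap.adjoint (M k i) ∘ₗ M k i = LinearMap.id)
    (ψ : Qudit a ⊗[ℂ] Qudit b) : ∑ k, ∑ i, ‖bobOp a (M k i) ψ‖ ^ 2 = ‖ψ‖ ^ 2 := by
  have h := sum_inner_bobOp M complete ψ ψ
  simp only [inner_self_eq_ofReal_norm_sq] at h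
  exact_mod_cast h

/-- If all Kraus operators of an instrument map the range of a nonzero multiple of an isometry
conformally, then one of them does so with a nonzero factor. -/
lemma exists_kraus_comp_smul {m : ℕ} {a' : ι → ℕ}
    (M : ∀ k, κ k → (Qudit a →ₗ[ℂ] Qudit (a' k)))
    (complete : ∑ k, ∑ i, LinearMap.adjoint (M k i) ∘ₗ M k i = LinearMap.id)
    {A : Qudit m →ₗ[ℂ] Qudit a} {c : ℂ} (hc : c ≠ 0) (hm : 0 < m)
    (hA : LinearMap.adjoint A ∘ₗ A = c • LinearMap.id)
    (h : ∀ k i, ∃ x : ℂ, LinearMap.adjoint (M k i ∘ₗ A) ∘ₗ (M k i ∘ₗ A) = x • LinearMap.id) :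
    ∃ k i, ∃ x : ℂ, x ≠ 0 ∧
      LinearMap.adjoint (M k i ∘ₗ A) ∘ₗ (M k i ∘ₗ A) = x • LinearMap.id := by
  by_contra! hcon
  have h0 : ∀ k i, LinearMap.adjoint (M k i ∘ₗ A) ∘ₗ (M k i ∘ₗ A) = 0 := by
    intro k i
    obtain ⟨x, hx⟩ := h k i
    by_cases hx0 : x = 0
    · rw [hx, hx0, zero_smul]
    · exact absurd hx (hcon k i x hx0)
  have hinner : ∀ k i v, inner ℂ (A v) ((LinearMap.adjoint (M k i) ∘ₗ M k i) (A v)) = 0 := by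
    intro k i v
    rw [← LinearMap.adjoint_inner_right]
    have := congr($(h0 k i) v)
    rw [LinearMap.adjoint_comp] at this
    simp only [LinearMap.comp_apply, LinearMap.zero_apply] at this ⊢
    rw [this, inner_zero_right]
  -- Summing over all Kraus operators, completeness would force `A v = 0`.
  have hAv : ∀ v, inner ℂ (A v) (A v) = 0 := by
    intro v
    have := congr(inner ℂ (A v) ($complete (A v)))
    simp only [LinearMap.sum_apply, inner_sum, hinner, Finset.sum_const_zero,
      LinearMap.id_apply] at this
    exact this.symm
  have h1 := hAv (EuclideanSpace.single ⟨0, hm⟩ 1)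
  rw [← LinearMap.adjoint_inner_right, ← LinearMap.comp_apply, hA] at h1
  simp [inner_smul_right, hc] at h1

end Instrument

/-! ### Output weights along a protocol -/

namespace LOCCProtocol

variable {J : Type}

lemma weight_nonneg {a b : ℕ} (P : LOCCProtocol J a b) (ψ : Qudit a ⊗[ℂ] Qudit b) (j : J) :
    0 ≤ P.weight ψ j := by
  induction P with
  | announce j' => rw [weight]; split_ifs <;> positivity
  | alice l r a' M complete next ih =>
    rw [weight]; exact Finset.sum_nonneg fun k _ => Finset.sum_nonneg fun i _ => ih k _
  | bob l r b' M complete next ih =>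
    rw [weight]; exact Finset.sum_nonneg fun k _ => Finset.sum_nonneg fun i _ => ih k _

lemma weight_alice_eq_zero_iff {a b l : ℕ} {r a' : Fin l → ℕ}
    {M : ∀ k, Fin (r k) → (Qudit a →ₗ[ℂ] Qudit (a' k))}
    {complete : ∑ k, ∑ i, LinearMap.adjoint (M k i) ∘ₗ M k i = LinearMap.id}
    {next : ∀ k, LOCCProtocol J (a' k) b} {ψ : Qudit a ⊗[ℂ] Qudit b} {j : J} :
    (alice l r a' M complete next).weight ψ j = 0 ↔
      ∀ k i, (next k).weight (aliceOp b (M k i) ψ) j = 0 := by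
  rw [weight, Finset.sum_eq_zero_iff_of_nonneg fun k _ =>
    Finset.sum_nonneg fun i _ => weight_nonneg _ _ _]
  refine ⟨fun h k i => ?_, fun h k _ => Finset.sum_eq_zero fun i _ => h k i⟩
  exact (Finset.sum_eq_zero_iff_of_nonneg fun i _ => weight_nonneg _ _ _).1
    (h k (Finset.mem_univ k)) i (Finset.mem_univ i)

lemma weight_bob_eq_zero_iff {a b l : ℕ} {r b' : Fin l → ℕ}
    {M : ∀ k, Fin (r k) → (Qudit b →ₗ[ℂ] Qudit (b' k))}
    {complete : ∑ k, ∑ i, LinearMap.adjoint (M k i) ∘ₗ M k i = LinearMap.id}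
    {next : ∀ k, LOCCProtocol J a (b' k)} {ψ : Qudit a ⊗[ℂ] Qudit b} {j : J} :
    (bob l r b' M complete next).weight ψ j = 0 ↔
      ∀ k i, (next k).weight (bobOp a (M k i) ψ) j = 0 := by
  rw [weight, Finset.sum_eq_zero_iff_of_nonneg fun k _ =>
    Finset.sum_nonneg fun i _ => weight_nonneg _ _ _]
  refine ⟨fun h k i => ?_, fun h k _ => Finset.sum_eq_zero fun i _ => h k i⟩
  exact (Finset.sum_eq_zero_iff_of_nonneg fun i _ => weight_nonneg _ _ _).1
    (h k (Finset.mem_univ k)) i (Finset.mem_univ i)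

/-- Two outputs suffice later: if the right one exhausts the norm, each wrong one has weight zero.
No sum over `J` is needed. -/
lemma weight_add_weight_le {a b : ℕ} (P : LOCCProtocol J a b) (ψ : Qudit a ⊗[ℂ] Qudit b)
    {j j' : J} (hj : j ≠ j') : P.weight ψ j + P.weight ψ j' ≤ ‖ψ‖ ^ 2 := by
  induction P with
  | announce i =>
    rw [weight, weight]
    split_ifs with h1 h2
    · exact absurd (h1.symm.trans h2) hj
    all_goals simp
  | alice l r a' M complete next ih =>
    rw [weight, weight, ← sum_norm_sq_aliceOp M complete ψ]
    simp only [← Finset.sum_add_distrib]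
    exact Finset.sum_le_sum fun k _ => Finset.sum_le_sum fun i _ => ih k _
  | bob l r b' M complete next ih =>
    rw [weight, weight, ← sum_norm_sq_bobOp M complete ψ]
    simp only [← Finset.sum_add_distrib]
    exact Finset.sum_le_sum fun k _ => Finset.sum_le_sum fun i _ => ih k _

/-- States with disjoint sets of possible outputs are orthogonal. -/
lemma inner_eq_zero_of_weight {a b : ℕ} (P : LOCCProtocol J a b) (φ ψ : Qudit a ⊗[ℂ] Qudit b)
    (h : ∀ j, P.weight φ j = 0 ∨ P.weight ψ j = 0) : inner ℂ φ ψ = 0 := by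
  induction P with
  | announce i =>
    -- Only the announced output `i` carries weight, so one of the two states is zero.
    have := h i
    simp only [weight, if_true, pow_eq_zero_iff two_ne_zero, norm_eq_zero] at this
    rcases this with rfl | rfl <;> simp
  | alice l r a' M complete next ih =>
    simp only [weight_alice_eq_zero_iff] at h
    rw [← sum_inner_aliceOp M complete φ ψ]
    exact Finset.sum_eq_zero fun k _ => Finset.sum_eq_zero fun i _ =>
      ih k _ _ fun j => (h j).imp (· k i) (· k i)
  | bob l r b' M complete next ih =>
    simp only [weight_bob_eq_zero_iff] at h
    rw [← sum_inner_bobOp M complete φ ψ]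
    exact Finset.sum_eq_zero fun k _ => Finset.sum_eq_zero fun i _ =>
      ih k _ _ fun j => (h j).imp (· k i) (· k i)

/-- If orthogonality-preserving local operators on a set of at least two nonzero states are
multiples of isometries, then no protocol discriminates a locally isometric image of it. -/
lemma exists_weight_ne_zero {m n : ℕ} (hm : 0 < m) (hn : 0 < n)
    {S : Set (Qudit m ⊗[ℂ] Qudit n)} (hS : S.Nontrivial) (hS0 : ∀ ψ ∈ S, ψ ≠ 0)
    (hA : ∀ (a : ℕ) (M : Qudit m →ₗ[ℂ] Qudit a),
      (S.Pairwise fun φ ψ => inner ℂ (aliceOp n M φ) (aliceOp n M ψ) = 0) →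
      ∃ c : ℂ, LinearMap.adjoint M ∘ₗ M = c • LinearMap.id)
    (hB : ∀ (b : ℕ) (M : Qudit n →ₗ[ℂ] Qudit b),
      (S.Pairwise fun φ ψ => inner ℂ (bobOp m M φ) (bobOp m M ψ) = 0) →
      ∃ c : ℂ, LinearMap.adjoint M ∘ₗ M = c • LinearMap.id)
    {a b : ℕ} (P : LOCCProtocol S a b) {A : Qudit m →ₗ[ℂ] Qudit a} {B : Qudit n →ₗ[ℂ] Qudit b}
    {c d : ℂ} (hc : c ≠ 0) (hd : d ≠ 0) (hAc : LinearMap.adjoint A ∘ₗ A = c • LinearMap.id)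
    (hBd : LinearMap.adjoint B ∘ₗ B = d • LinearMap.id) :
    ∃ ψ j : S, j ≠ ψ ∧ P.weight (TensorProduct.map A B ψ) j ≠ 0 := by
  induction P generalizing c d with
  | announce j =>
    obtain ⟨ψ, hψ, hne⟩ := hS.exists_ne j
    refine ⟨⟨ψ, hψ⟩, j, fun h => hne (by rw [h]), ?_⟩
    rw [weight, if_pos rfl]
    have h1 := map_comp_smul hAc hBd ψ ψ
    have h2 : inner ℂ ψ ψ ≠ 0 := inner_self_ne_zero.2 (hS0 ψ hψ)
    intro h3
    rw [pow_eq_zero_iff two_ne_zero, norm_eq_zero] at h3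
    simp only [h3, inner_zero_left] at h1
    exact mul_ne_zero (mul_ne_zero hc hd) h2 h1.symm
  | @alice a b l r a' M complete next ih =>
    by_contra! hcon
    simp only [weight_alice_eq_zero_iff] at hcon
    have hstep : ∀ k i (ψ : Qudit m ⊗[ℂ] Qudit n),
        aliceOp b (M k i) (TensorProduct.map A B ψ) = TensorProduct.map (M k i ∘ₗ A) B ψ := by
      intro k i ψ
      rw [aliceOp, ← LinearMap.comp_apply, ← TensorProduct.map_comp, LinearMap.id_comp]
    simp only [hstep] at hcon
    -- Rigidity applies to the accumulated operator `M k i ∘ₗ A`, which acts on the original space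
    -- where `S` lives. Each output is wrong for `φ` or for `ψ`, so their images are orthogonal; the
    -- conformal factor `B` is then cancelled.
    obtain ⟨k, i, x, hx, hx'⟩ := exists_kraus_comp_smul M complete hc hm hAc (fun k i => by
      refine hA _ _ fun φ hφ ψ hψ hne => ?_
      have h1 := inner_eq_zero_of_weight (next k) (TensorProduct.map (M k i ∘ₗ A) B φ)
        (TensorProduct.map (M k i ∘ₗ A) B ψ) fun j => by
          by_cases hj : j = ⟨φ, hφ⟩
          · exact Or.inr (hcon ⟨ψ, hψ⟩ j (fun h => hne (congrArg Subtype.val (hj.symm.trans h))) k i)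
          · exact Or.inl (hcon ⟨φ, hφ⟩ j hj k i)
      have h2 : ∀ ψ : Qudit m ⊗[ℂ] Qudit n, TensorProduct.map (M k i ∘ₗ A) B ψ =
          TensorProduct.map LinearMap.id B (aliceOp n (M k i ∘ₗ A) ψ) := by
        intro ψ
        rw [aliceOp, ← LinearMap.comp_apply, ← TensorProduct.map_comp, LinearMap.id_comp,
          LinearMap.comp_id]
      rw [h2, h2, map_comp_smul (c := 1) (by simp) hBd, one_mul] at h1
      exact (mul_eq_zero.1 h1).resolve_left hd)
    obtain ⟨ψ, j, hne, hw⟩ := ih k hx hd hx' hBd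
    exact hw (hcon ψ j hne k i)
  | @bob a b l r b' M complete next ih =>
    by_contra! hcon
    simp only [weight_bob_eq_zero_iff] at hcon
    have hstep : ∀ k i (ψ : Qudit m ⊗[ℂ] Qudit n),
        bobOp a (M k i) (TensorProduct.map A B ψ) = TensorProduct.map A (M k i ∘ₗ B) ψ := by
      intro k i ψ
      rw [bobOp, ← LinearMap.comp_apply, ← TensorProduct.map_comp, LinearMap.id_comp]
    simp only [hstep] at hcon
    obtain ⟨k, i, x, hx, hx'⟩ := exists_kraus_comp_smul M complete hd hn hBd (fun k i => by
      refine hB _ _ fun φ hφ ψ hψ hne => ?_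
      have h1 := inner_eq_zero_of_weight (next k) (TensorProduct.map A (M k i ∘ₗ B) φ)
        (TensorProduct.map A (M k i ∘ₗ B) ψ) fun j => by
          by_cases hj : j = ⟨φ, hφ⟩
          · exact Or.inr (hcon ⟨ψ, hψ⟩ j (fun h => hne (congrArg Subtype.val (hj.symm.trans h))) k i)
          · exact Or.inl (hcon ⟨φ, hφ⟩ j hj k i)
      have h2 : ∀ ψ : Qudit m ⊗[ℂ] Qudit n, TensorProduct.map A (M k i ∘ₗ B) ψ =
          TensorProduct.map A LinearMap.id (bobOp m (M k i ∘ₗ B) ψ) := by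
        intro ψ
        rw [bobOp, ← LinearMap.comp_apply, ← TensorProduct.map_comp, LinearMap.id_comp,
          LinearMap.comp_id]
      rw [h2, h2, map_comp_smul hAc (d := 1) (by simp), mul_one] at h1
      exact (mul_eq_zero.1 h1).resolve_left hc)
    obtain ⟨ψ, j, hne, hw⟩ := ih k hc hx hAc hx'
    exact hw (hcon ψ j hne k i)

end LOCCProtocol

lemma not_LOCCDistinguishable_of_rigid {m n : ℕ} (hm : 0 < m) (hn : 0 < n)
    {S : Set (Qudit m ⊗[ℂ] Qudit n)} (hS : S.Nontrivial) (hS0 : ∀ ψ ∈ S, ψ ≠ 0)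
    (hA : ∀ (a : ℕ) (M : Qudit m →ₗ[ℂ] Qudit a),
      (S.Pairwise fun φ ψ => inner ℂ (aliceOp n M φ) (aliceOp n M ψ) = 0) →
      ∃ c : ℂ, LinearMap.adjoint M ∘ₗ M = c • LinearMap.id)
    (hB : ∀ (b : ℕ) (M : Qudit n →ₗ[ℂ] Qudit b),
      (S.Pairwise fun φ ψ => inner ℂ (bobOp m M φ) (bobOp m M ψ) = 0) →
      ∃ c : ℂ, LinearMap.adjoint M ∘ₗ M = c • LinearMap.id) :
    ¬ LOCCDistinguishable S := by
  rintro ⟨P, hP⟩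
  obtain ⟨ψ, j, hne, hw⟩ := P.exists_weight_ne_zero hm hn hS hS0 hA hB one_ne_zero one_ne_zero
    (A := LinearMap.id) (B := LinearMap.id) (by simp) (by simp)
  rw [TensorProduct.map_id, LinearMap.id_apply] at hw
  have h1 := P.weight_add_weight_le ψ hne
  have h2 := P.weight_nonneg ψ j
  rw [hP ψ] at h1
  exact hw (le_antisymm (by linarith) h2)

/-! ### Orthogonality and number of the strip states -/

lemma ket_ne_zero {d i : ℕ} (hi : i < d) : ket d i ≠ 0 := by
  intro h
  have := inner_ket_ket (j := i) hi
  simp [h] at this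

lemma inner_ket_lowFourier {d i : ℕ} (hi : i < d) (s : ℕ) :
    inner ℂ (ket d i) (lowFourier d s) = if i < d - 1 then stripRoot d ^ (s * i) else 0 := by
  simp [lowFourier, inner_ket_ket hi]

lemma inner_ket_highFourier {d i : ℕ} (hi : i < d) (s : ℕ) :
    inner ℂ (ket d i) (highFourier d s) =
      if i = 0 then 0 else stripRoot d ^ (s * (i - 1)) := by
  simp only [highFourier, inner_sum, inner_smul_right, inner_ket_ket hi]
  rcases i with _ | i
  · simp
  · simp only [Nat.add_right_cancel_iff, mul_ite, mul_one, mul_zero, Finset.sum_ite_eq,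
      Finset.mem_range]
    rw [if_pos (by omega)]
    simp

lemma inner_lowFourier {d s t : ℕ} (hd : 2 ≤ d) (hs : s < d - 1) (ht : t < d - 1) :
    inner ℂ (lowFourier d s) (lowFourier d t) = if s = t then ((d - 1 : ℕ) : ℂ) else 0 := by
  rw [lowFourier, sum_inner]
  -- Here the sum runs over positions instead of frequencies, which is harmless as the exponent is
  -- symmetric. The conjugated first slot puts `t` before `s`.
  have h := (isPrimitiveRoot_stripRoot hd).sum_pow_mul_conj_pow ht hs
  simp only [eq_comm (a := s)]
  rw [← h]
  refine Finset.sum_congr rfl fun j hj => ?_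
  have hj := Finset.mem_range.1 hj
  rw [inner_smul_left, inner_ket_lowFourier (by omega), if_pos hj, mul_comm s, mul_comm t, mul_comm]

lemma inner_highFourier {d s t : ℕ} (hd : 2 ≤ d) (hs : s < d - 1) (ht : t < d - 1) :
    inner ℂ (highFourier d s) (highFourier d t) = if s = t then ((d - 1 : ℕ) : ℂ) else 0 := by
  rw [highFourier, sum_inner]
  have h := (isPrimitiveRoot_stripRoot hd).sum_pow_mul_conj_pow ht hs
  simp only [eq_comm (a := s)]
  rw [← h]
  refine Finset.sum_congr rfl fun j hj => ?_
  have hj := Finset.mem_range.1 hj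
  rw [inner_smul_left, inner_ket_highFourier (by omega), if_neg (by omega), Nat.add_sub_cancel,
    mul_comm s, mul_comm t, mul_comm]

/-- The states of `stripSet m n`, indexed by strip and frequency. -/
noncomputable def stripState (m n : ℕ) :
    (Fin (n - 1) ⊕ Fin (m - 1)) ⊕ (Fin (n - 1) ⊕ Fin (m - 1)) → Qudit m ⊗[ℂ] Qudit n
  | .inl (.inl σ) => ket m 0 ⊗ₜ[ℂ] lowFourier n σ
  | .inl (.inr η) => lowFourier m η ⊗ₜ[ℂ] ket n (n - 1)
  | .inr (.inl σ) => ket m (m - 1) ⊗ₜ[ℂ] highFourier n σ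
  | .inr (.inr η) => highFourier m η ⊗ₜ[ℂ] ket n 0

lemma range_stripState (m n : ℕ) : Set.range (stripState m n) = stripSet m n := by
  ext ψ
  simp only [Set.mem_range, Sum.exists, stripState, stripSet, Set.mem_ofPred_eq, Fin.exists_iff,
    exists_prop, or_assoc, eq_comm (b := ψ)]

lemma inner_stripState_self_ne_zero {m n : ℕ} (hm : 2 ≤ m) (hn : 2 ≤ n) (i) :
    inner ℂ (stripState m n i) (stripState m n i) ≠ 0 := by
  have hm' : ((m - 1 : ℕ) : ℂ) ≠ 0 := by exact_mod_cast (by omega : m - 1 ≠ 0)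
  have hn' : ((n - 1 : ℕ) : ℂ) ≠ 0 := by exact_mod_cast (by omega : n - 1 ≠ 0)
  rcases i with (σ | η) | (σ | η)
  · simpa only [stripState, TensorProduct.inner_tmul, inner_ket_ket (show 0 < m by omega),
      inner_lowFourier hn σ.2 σ.2, if_true, one_mul] using hn'
  · simpa only [stripState, TensorProduct.inner_tmul, inner_ket_ket (show n - 1 < n by omega),
      inner_lowFourier hm η.2 η.2, if_true, mul_one] using hm'
  · simpa only [stripState, TensorProduct.inner_tmul, inner_ket_ket (show m - 1 < m by omega),
      inner_highFourier hn σ.2 σ.2, if_true, one_mul] using hn'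
  · simpa only [stripState, TensorProduct.inner_tmul, inner_ket_ket (show 0 < n by omega),
      inner_highFourier hm η.2 η.2, if_true, mul_one] using hm'

lemma inner_stripState_of_ne {m n : ℕ} (hm : 2 ≤ m) (hn : 2 ≤ n) {i j} (hij : i ≠ j) :
    inner ℂ (stripState m n i) (stripState m n j) = 0 := by
  have hm0 : 0 < m := by omega
  have hn0 : 0 < n := by omega
  have hm1 : m - 1 < m := by omega
  have hn1 : n - 1 < n := by omega
  have hm2 : 0 ≠ m - 1 := by omega
  have hn2 : 0 ≠ n - 1 := by omega
  have klow : ∀ {d : ℕ}, 2 ≤ d → ∀ s, inner ℂ (ket d (d - 1)) (lowFourier d s) = 0 :=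
    fun hd s => by rw [inner_ket_lowFourier (by omega), if_neg (lt_irrefl _)]
  have khigh : ∀ {d : ℕ}, 2 ≤ d → ∀ s, inner ℂ (ket d 0) (highFourier d s) = 0 :=
    fun hd s => by rw [inner_ket_highFourier (by omega), if_pos rfl]
  have lowk : ∀ {d : ℕ}, 2 ≤ d → ∀ s, inner ℂ (lowFourier d s) (ket d (d - 1)) = 0 :=
    fun hd s => inner_eq_zero_symm.1 (klow hd s)
  have highk : ∀ {d : ℕ}, 2 ≤ d → ∀ s, inner ℂ (highFourier d s) (ket d 0) = 0 :=
    fun hd s => inner_eq_zero_symm.1 (khigh hd s)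
  -- Opposite strips have distinct kets in one factor; for adjacent strips, a ket lies outside the
  -- support of a Fourier vector. Only the four pairs within one strip remain.
  rcases i with (i | i) | (i | i) <;> rcases j with (j | j) | (j | j) <;>
    simp only [stripState, TensorProduct.inner_tmul, klow hm, klow hn, khigh hm, khigh hn,
      lowk hm, lowk hn, highk hm, highk hn, inner_ket_ket hm0, inner_ket_ket hn0,
      inner_ket_ket hm1, inner_ket_ket hn1, if_neg hm2, if_neg hn2, if_neg hm2.symm,
      if_neg hn2.symm, mul_zero, zero_mul]
  all_goals
    have hij' : (i : ℕ) ≠ j := fun h => hij (by rw [Fin.ext h])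
  · rw [inner_lowFourier hn i.2 j.2, if_neg hij', mul_zero]
  · rw [inner_lowFourier hm i.2 j.2, if_neg hij', zero_mul]
  · rw [inner_highFourier hn i.2 j.2, if_neg hij', mul_zero]
  · rw [inner_highFourier hm i.2 j.2, if_neg hij', zero_mul]

lemma stripState_injective {m n : ℕ} (hm : 2 ≤ m) (hn : 2 ≤ n) :
    Function.Injective (stripState m n) := by
  intro i j hij
  by_contra h
  refine inner_stripState_self_ne_zero hm hn i ?_
  have := inner_stripState_of_ne hm hn h
  rwa [← hij] at this

lemma ncard_stripSet {m n : ℕ} (hm : 2 ≤ m) (hn : 2 ≤ n) :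
    (stripSet m n).ncard = 2 * (m + n) - 4 := by
  rw [← range_stripState, ← Set.image_univ,
    Set.ncard_image_of_injective _ (stripState_injective hm hn), Set.ncard_univ]
  simp only [Nat.card_eq_fintype_card, Fintype.card_sum, Fintype.card_fin]
  omega

lemma isOPS_stripSet {m n : ℕ} (hm : 2 ≤ m) (hn : 2 ≤ n) : IsOPS (stripSet m n) := by
  rw [← range_stripState]
  refine ⟨?_, ?_⟩
  · rintro _ ⟨i, rfl⟩
    refine ⟨fun h => inner_stripState_self_ne_zero hm hn i (by rw [h, inner_zero_left]), ?_⟩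
    rcases i with (i | i) | (i | i) <;> exact ⟨_, _, rfl⟩
  · rintro _ ⟨i, rfl⟩ _ ⟨j, rfl⟩ hij
    exact inner_stripState_of_ne hm hn fun h => hij (by rw [h])

/-! ### Rigidity of the strip set -/

lemma inner_ket_zero_lowFourier_ne_zero {d : ℕ} (hd : 2 ≤ d) (s : ℕ) :
    inner ℂ (ket d 0) (lowFourier d s) ≠ 0 := by
  rw [inner_ket_lowFourier (by omega), if_pos (by omega)]
  simp

lemma inner_ket_last_highFourier_ne_zero {d : ℕ} (hd : 2 ≤ d) (s : ℕ) :
    inner ℂ (ket d (d - 1)) (highFourier d s) ≠ 0 := by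
  rw [inner_ket_highFourier (by omega), if_neg (by omega)]
  exact pow_ne_zero _ ((isPrimitiveRoot_stripRoot hd).ne_zero (by omega))

lemma stripSet_alice_rigid {m n : ℕ} (hm : 3 ≤ m) (hn : 2 ≤ n) (a : ℕ)
    (M : Qudit m →ₗ[ℂ] Qudit a)
    (h : (stripSet m n).Pairwise fun φ ψ => inner ℂ (aliceOp n M φ) (aliceOp n M ψ) = 0) :
    ∃ c : ℂ, LinearMap.adjoint M ∘ₗ M = c • LinearMap.id := by
  rw [← range_stripState] at h
  have h' : ∀ i j, i ≠ j →
      inner ℂ (aliceOp n M (stripState m n i)) (aliceOp n M (stripState m n j)) = 0 :=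
    fun i j hij => h ⟨i, rfl⟩ ⟨j, rfl⟩ ((stripState_injective (by omega) hn).ne hij)
  refine adjoint_comp_eq_smul_of_fourier hm M ?_ ?_ ?_ ?_
  · intro s hs t ht hst
    have := h' (.inl (.inr ⟨s, hs⟩)) (.inl (.inr ⟨t, ht⟩)) (by simpa using hst)
    simpa [stripState, aliceOp, ket_ne_zero (show n - 1 < n by omega)] using this
  · intro s hs t ht hst
    have := h' (.inr (.inr ⟨s, hs⟩)) (.inr (.inr ⟨t, ht⟩)) (by simpa using hst)
    simpa [stripState, aliceOp, ket_ne_zero (show 0 < n by omega)] using this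
  -- Adjacent strips overlap at a corner: Bob's inner product is nonzero there, so orthogonality
  -- must come from Alice's factor. Frequency 0 is an arbitrary choice.
  · intro s hs
    have := h' (.inl (.inr ⟨s, hs⟩)) (.inr (.inl ⟨0, by omega⟩)) (by simp)
    simpa [stripState, aliceOp, inner_ket_last_highFourier_ne_zero hn] using this
  · intro s hs
    have := h' (.inr (.inr ⟨s, hs⟩)) (.inl (.inl ⟨0, by omega⟩)) (by simp)
    simpa [stripState, aliceOp, inner_ket_zero_lowFourier_ne_zero hn] using this

lemma stripSet_bob_rigid {m n : ℕ} (hm : 2 ≤ m) (hn : 3 ≤ n) (b : ℕ)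
    (M : Qudit n →ₗ[ℂ] Qudit b)
    (h : (stripSet m n).Pairwise fun φ ψ => inner ℂ (bobOp m M φ) (bobOp m M ψ) = 0) :
    ∃ c : ℂ, LinearMap.adjoint M ∘ₗ M = c • LinearMap.id := by
  rw [← range_stripState] at h
  have h' : ∀ i j, i ≠ j →
      inner ℂ (bobOp m M (stripState m n i)) (bobOp m M (stripState m n j)) = 0 :=
    fun i j hij => h ⟨i, rfl⟩ ⟨j, rfl⟩ ((stripState_injective hm (by omega)).ne hij)
  refine adjoint_comp_eq_smul_of_fourier hn M ?_ ?_ ?_ ?_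
  · intro s hs t ht hst
    have := h' (.inl (.inl ⟨s, hs⟩)) (.inl (.inl ⟨t, ht⟩)) (by simpa using hst)
    simpa [stripState, bobOp, ket_ne_zero (show 0 < m by omega)] using this
  · intro s hs t ht hst
    have := h' (.inr (.inl ⟨s, hs⟩)) (.inr (.inl ⟨t, ht⟩)) (by simpa using hst)
    simpa [stripState, bobOp, ket_ne_zero (show m - 1 < m by omega)] using this
  · intro s hs
    have := h' (.inl (.inl ⟨s, hs⟩)) (.inl (.inr ⟨0, by omega⟩)) (by simp)
    simpa [stripState, bobOp, inner_ket_zero_lowFourier_ne_zero hm] using this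
  · intro s hs
    have := h' (.inr (.inl ⟨s, hs⟩)) (.inr (.inr ⟨0, by omega⟩)) (by simp)
    simpa [stripState, bobOp, inner_ket_last_highFourier_ne_zero hm] using this

theorem theorem2 (m n : ℕ) (hm : 3 ≤ m) (hmn : m ≤ n) :
    (stripSet m n).ncard = 2 * (m + n) - 4 ∧
    IsNonlocal (stripSet m n) ∧
    (∀ (a : ℕ) (M : Qudit m →ₗ[ℂ] Qudit a),
      ((stripSet m n).Pairwise fun φ ψ => inner ℂ (aliceOp n M φ) (aliceOp n M ψ) = 0) →
      ∃ c : ℂ, LinearMap.adjoint M ∘ₗ M = c • LinearMap.id) ∧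
    (∀ (b : ℕ) (M : Qudit n →ₗ[ℂ] Qudit b),
      ((stripSet m n).Pairwise fun φ ψ => inner ℂ (bobOp m M φ) (bobOp m M ψ) = 0) →
      ∃ c : ℂ, LinearMap.adjoint M ∘ₗ M = c • LinearMap.id) := by
  have hm2 : 2 ≤ m := by omega
  have hn2 : 2 ≤ n := by omega
  have hcard := ncard_stripSet hm2 hn2
  have hops := isOPS_stripSet hm2 hn2
  have hA := stripSet_alice_rigid hm hn2
  have hB := stripSet_bob_rigid hm2 (hm.trans hmn)
  have hnt : (stripSet m n).Nontrivial := by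
    obtain ⟨x, hx, y, hy, hxy⟩ := (Set.one_lt_ncard_iff_nontrivial_and_finite.1
      (show 1 < (stripSet m n).ncard by omega)).1
    exact ⟨x, hx, y, hy, hxy⟩
  exact ⟨hcard, ⟨hops, not_LOCCDistinguishable_of_rigid (by omega) (by omega) hnt
    (fun ψ hψ => (hops.1 ψ hψ).1) hA hB⟩, hA, hB⟩
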